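/- Let $d\ge 1$ and $p\ge 2$ be integers. Let $\mathcal T_{d,p,n}$ be the (finite) set of full $p$-ary plane trees (every internal node has exactly $p$ ordered children) with $n$ leaves in which every internal node carries a label from $\{1,\dots,d\}$. For a tree $T$ define a set $f(T)$ of open subrectangles of $(0,1)^d$ recursively: if $T$ is a single node, $f(T)=\{(0,1)^d\}$; if $T$ has root label $i$ and subtrees $T_1,\dots,T_p$ at the root, then $f(T)$ is the set of all images of regions $R\in f(T_j)$, $1\le j\le p$, under the affine map that replaces the coordinate $x_i$ by $(x_i+j-1)/p$ and fixes the other coordinates. Call $T$ interchange maximal if there is no subtree $\tilde T$ of $T$ (a node of $T$ with all its descendants), with root label $i$, for which there is a tree $\tilde T'$ with root label $j>i$ and $f(\tilde T')=f(\tilde T)$. Let $\mathcal T^+_{d,p,n}\subseteq\mathcal T_{d,p,n}$ be the set of interchange maximal trees, and put $w=\sum_{n\ge 1}|\mathcal T^+_{d,p,n}|\,x^n$. Then, as formal power series, $$\sum_{i=0}^d(-1)^i\binom{d}{i}\,w^{p^i}=x .$$ Let moreover $\mathcal D_{d,p,n}$ be the set of $(d,p,n)$-decompositions: the sets of open rectangles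 obtained from $\{(0,1)^d\}$ by $m$ successive steps, where $n=1+m(p-1)$ and each step replaces one rectangle of the current set by the $p$ equal open slices into which it is cut orthogonally to one coordinate axis. Let $C_{d,p}(n)=|\mathcal D_{d,p,n}|$. Then, for every $n$, $f$ restricts to a bijection $\mathcal T^+_{d,p,n}\to\mathcal D_{d,p,n}$; consequently $y=\sum_{n\ge 0}C_{d,p}(n)\,x^n$ also satisfies $$\sum_{i=0}^d(-1)^i\binom{d}{i}\,y^{p^i}=x .$$ -/

import Mathlib

noncomputable section

namespace HypercubeTrees

/-- The open rectangle with corners `a` and `b` in `ℝ^d`. -/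
def rect {d : ℕ} (a b : Fin d → ℝ) : Set (Fin d → ℝ) :=
  {x | ∀ k, a k < x k ∧ x k < b k}

/-- The open unit hypercube `(0,1)^d`. -/
def cube (d : ℕ) : Set (Fin d → ℝ) :=
  rect (fun _ => 0) (fun _ => 1)

/-- The `p` equal open slices of the rectangle with corners `a` and `b`, cut orthogonally to the
`i`-th coordinate axis. -/
def slices {d : ℕ} (p : ℕ) (i : Fin d) (a b : Fin d → ℝ) : Set (Set (Fin d → ℝ)) :=
  Set.range fun j : Fin p =>
    rect (Function.update a i (a i + ((j : ℕ) : ℝ) / (p : ℝ) * (b i - a i)))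
      (Function.update b i (a i + (((j : ℕ) : ℝ) + 1) / (p : ℝ) * (b i - a i)))

/-- `IsDecomp p m D`: the set of regions `D` arises from the undivided open unit hypercube by `m`
successive steps, each of which replaces one region by its `p` equal slices orthogonal to one
coordinate axis. -/
inductive IsDecomp {d : ℕ} (p : ℕ) : ℕ → Set (Set (Fin d → ℝ)) → Prop
  | zero : IsDecomp p 0 {cube d}
  | step {m : ℕ} {D : Set (Set (Fin d → ℝ))} (a b : Fin d → ℝ) (i : Fin d) :
      IsDecomp p m D → (∀ k, a k < b k) → rect a b ∈ D →
      IsDecomp p (m + 1) ((D \ {rect a b}) ∪ slices p i a b)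

/-- The set of `(d,p,n)`-decompositions of the hypercube. -/
def decompositions (d p n : ℕ) : Set (Set (Set (Fin d → ℝ))) :=
  {D | ∃ m : ℕ, n = 1 + m * (p - 1) ∧ IsDecomp p m D}

/-- `C_{d,p}(n)`: the number of distinct `(d,p,n)`-decompositions. -/
def decompCount (d p n : ℕ) : ℕ :=
  (decompositions d p n).ncard

/-- Full (plane) `p`-ary trees whose internal nodes carry one of `d` labels. -/
inductive PTree (d p : ℕ) : Type
  | leaf : PTree d p
  | node (i : Fin d) (c : Fin p → PTree d p) : PTree d p

/-- The number of leaves of a tree. -/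
def PTree.leaves {d p : ℕ} : PTree d p → ℕ
  | .leaf => 1
  | .node _ c => ∑ j, (c j).leaves

/-- `IsSubtree S T`: `S` is the subtree of `T` consisting of some node of `T` together with all its
descendants. -/
inductive IsSubtree {d p : ℕ} (S : PTree d p) : PTree d p → Prop
  | refl : IsSubtree S S
  | child (i : Fin d) (c : Fin p → PTree d p) (j : Fin p) :
      IsSubtree S (c j) → IsSubtree S (.node i c)

/-- The affine map which translates by `j` along the `i`-th axis and then compresses by a factor
of `p` along this axis. -/
def place {d p : ℕ} (i : Fin d) (j : Fin p) (x : Fin d → ℝ) : Fin d → ℝ :=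
  Function.update x i ((x i + ((j : ℕ) : ℝ)) / (p : ℝ))

/-- The hypercube decomposition described by a tree. -/
def PTree.decomp {d p : ℕ} : PTree d p → Set (Set (Fin d → ℝ))
  | .leaf => {cube d}
  | .node i c => ⋃ j, (fun R => place i j '' R) '' (c j).decomp

/-- A tree is interchange maximal if no subtree of it, with root label `i` say, describes the same
decomposition as some tree whose root label is greater than `i`. -/
def PTree.InterchangeMaximal {d p : ℕ} (T : PTree d p) : Prop :=
  ¬ ∃ (i : Fin d) (c : Fin p → PTree d p), IsSubtree (.node i c) T ∧
      ∃ (j : Fin d) (c' : Fin p → PTree d p), i < j ∧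
        PTree.decomp (.node j c') = PTree.decomp (.node i c)

/-- The set of interchange maximal trees with `n` leaves. -/
def maximalTrees (d p n : ℕ) : Set (PTree d p) :=
  {T | T.leaves = n ∧ T.InterchangeMaximal}

/-- The generating function of interchange maximal trees by number of leaves; for `p ≥ 1` no tree
has `0` leaves, so the constant coefficient is `0`. -/
def treeSeries (d p : ℕ) : PowerSeries ℤ :=
  PowerSeries.mk fun n => ((maximalTrees d p n).ncard : ℤ)

/-- The generating function of the numbers `C_{d,p}(n)`. -/
def decompSeries (d p : ℕ) : PowerSeries ℤ :=
  PowerSeries.mk fun n => (decompCount d p n : ℤ)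

end HypercubeTrees

end

noncomputable section
namespace HypercubeTrees

variable {d p : ℕ}

/-! ### Rectangles, slabs and the maps `place` -/

/-! For a decomposition `D` coming from a tree, consider the set of all labels that occur at the
root of some tree describing `D`. Cuts along different axes commute, and label `k` is possible
exactly when every region of `D` lies in a slab orthogonal to axis `k`. Hence, for `k ≠ i`, a tree
with root label `i` admits `k` as an alternative root label iff all its children do
(`hasRoot_decomp_node_iff`).

Let `y` be the series of all tree decompositions. Peeling off the labels of `S` one at a time, each
peeling turning a decomposition into a `p`-tuple, shows that the decompositions admitting every
label of `S` have series `y ^ p ^ S.card` (`rootSeries_eq_pow`). The alternating sum over `S` counts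
each `D` with weight `∑ (-1) ^ S.card` over subsets of its set of possible labels, which vanishes
unless that set is empty, i.e. unless `D` is the uncut cube; this leaves `x`.

It remains to identify the objects counted. Always taking the largest possible root label gives each
tree decomposition exactly one interchange maximal tree, and successive slicing produces exactly the
tree decompositions (`IsDecomp.exists_tree`, `exists_isDecomp`). -/

/-- The `j`-th of the `p` slabs into which the hyperplanes orthogonal to the `i`-th axis cut. -/
def slab (p : ℕ) (i : Fin d) (j : Fin p) : Set (Fin d → ℝ) :=
  {x | ((j : ℕ) : ℝ) / p < x i ∧ x i < (((j : ℕ) : ℝ) + 1) / p}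

/-- The union of the copies of the families `E j` placed in the slabs along the `i`-th axis. -/
def join (i : Fin d) (E : Fin p → Set (Set (Fin d → ℝ))) : Set (Set (Fin d → ℝ)) :=
  ⋃ j, (fun R => place i j '' R) '' E j

theorem decomp_node (i : Fin d) (c : Fin p → PTree d p) :
    PTree.decomp (.node i c) = join i fun j => (c j).decomp := rfl

theorem mem_join {i : Fin d} {E : Fin p → Set (Set (Fin d → ℝ))} {R : Set (Fin d → ℝ)} :
    R ∈ join i E ↔ ∃ j, ∃ S ∈ E j, place i j '' S = R := by
  simp [join]

theorem cast_pos_of_fin (j : Fin p) : (0 : ℝ) < p := by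
  exact_mod_cast j.pos

theorem place_same (i : Fin d) (j : Fin p) (x : Fin d → ℝ) :
    place i j x i = (x i + ((j : ℕ) : ℝ)) / p := by
  simp [place]

theorem place_ne {i k : Fin d} (h : k ≠ i) (j : Fin p) (x : Fin d → ℝ) :
    place i j x k = x k := by
  simp [place, h]

theorem place_injective (i : Fin d) (j : Fin p) : Function.Injective (place i j) := by
  intro x y h
  have hp := cast_pos_of_fin j
  ext k
  have hk := congrFun h k
  by_cases hki : k = i
  · subst hki
    rw [place_same, place_same] at hk
    field_simp at hk
    linarith
  · rwa [place_ne hki, place_ne hki] at hk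

theorem image_place_injective (i : Fin d) (j : Fin p) :
    Function.Injective fun R : Set (Fin d → ℝ) => place i j '' R :=
  (place_injective i j).image_injective

theorem place_comm {i k : Fin d} (h : k ≠ i) (j l : Fin p) (x : Fin d → ℝ) :
    place i j (place k l x) = place k l (place i j x) := by
  ext m
  by_cases hi : m = i
  · subst hi
    rw [place_same, place_ne h.symm, place_ne h.symm, place_same]
  · by_cases hk : m = k
    · subst hk
      rw [place_same, place_ne h, place_ne h, place_same]
    · rw [place_ne hi, place_ne hk, place_ne hk, place_ne hi]

theorem place_lt_iff (i : Fin d) (j : Fin p) (x y : Fin d → ℝ) (k : Fin d) :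
    place i j x k < place i j y k ↔ x k < y k := by
  have hp := cast_pos_of_fin j
  by_cases hk : k = i
  · subst hk
    rw [place_same, place_same, div_lt_div_iff_of_pos_right hp, add_lt_add_iff_right]
  · rw [place_ne hk, place_ne hk]

theorem place_surjective (i : Fin d) (j : Fin p) : Function.Surjective (place i j) := by
  intro y
  have hp := cast_pos_of_fin j
  refine ⟨Function.update y i (p * y i - ((j : ℕ) : ℝ)), ?_⟩
  ext k
  by_cases hk : k = i
  · subst hk
    rw [place_same, Function.update_self]
    field_simp
    ring
  · rw [place_ne hk, Function.update_of_ne hk]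

theorem image_place_rect (i : Fin d) (j : Fin p) (a b : Fin d → ℝ) :
    place i j '' rect a b = rect (place i j a) (place i j b) := by
  ext y
  obtain ⟨x, rfl⟩ := place_surjective i j y
  rw [(place_injective i j).mem_set_image]
  simp [rect, place_lt_iff]

theorem rect_nonempty {a b : Fin d → ℝ} (h : ∀ k, a k < b k) : (rect a b).Nonempty :=
  ⟨fun k => (a k + b k) / 2, fun k => ⟨by linarith [h k], by linarith [h k]⟩⟩

theorem le_of_rect_subset {a b a' b' : Fin d → ℝ} (h : ∀ k, a k < b k)
    (hs : rect a b ⊆ rect a' b') (k : Fin d) : a' k ≤ a k ∧ b k ≤ b' k := by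
  have key : ∀ t, a k < t → t < b k → a' k < t ∧ t < b' k := by
    intro t h1 h2
    -- Only coordinate `k` varies; the others stay at the midpoints, so membership tests a single
    -- coordinate.
    have hm : Function.update (fun m => (a m + b m) / 2) k t ∈ rect a b := by
      intro m
      by_cases hm : m = k
      · subst hm
        simp [h1, h2]
      · simp only [Function.update_of_ne hm]
        constructor <;> linarith [h m]
    simpa using hs hm k
  constructor
  · refine le_of_forall_gt_imp_ge_of_dense fun t ht => ?_
    by_cases htb : t < b k
    · exact (key t ht htb).1.le
    · have := (key ((a k + b k) / 2) (by linarith [h k]) (by linarith [h k])).1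
      linarith [h k]
  · refine le_of_forall_lt_imp_le_of_dense fun t ht => ?_
    by_cases hta : a k < t
    · exact (key t hta ht).2.le
    · have := (key ((a k + b k) / 2) (by linarith [h k]) (by linarith [h k])).2
      linarith [h k]

theorem rect_inj {a b a' b' : Fin d → ℝ} (h : ∀ k, a k < b k) (h' : ∀ k, a' k < b' k)
    (hs : rect a b = rect a' b') : a = a' ∧ b = b' := by
  have h1 := le_of_rect_subset h hs.subset
  have h2 := le_of_rect_subset h' hs.symm.subset
  exact ⟨funext fun k => le_antisymm (h2 k).1 (h1 k).1,
    funext fun k => le_antisymm (h1 k).2 (h2 k).2⟩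

theorem place_mem_cube {i : Fin d} {j : Fin p} {x : Fin d → ℝ} (hx : x ∈ cube d) :
    place i j x ∈ cube d := by
  have hp := cast_pos_of_fin j
  intro k
  by_cases hk : k = i
  · subst hk
    have hj : ((j : ℕ) : ℝ) + 1 ≤ p := by exact_mod_cast j.isLt
    have h0 : (0 : ℝ) ≤ ((j : ℕ) : ℝ) := Nat.cast_nonneg _
    have := hx k
    simp only at this ⊢
    rw [place_same, div_lt_one hp]
    exact ⟨div_pos (by linarith) hp, by linarith⟩
  · simpa [place_ne hk] using hx k

theorem place_mem_slab {i : Fin d} {j : Fin p} {x : Fin d → ℝ} (hx : x ∈ cube d) :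
    place i j x ∈ slab p i j := by
  have hp := cast_pos_of_fin j
  have := hx i
  simp only at this
  simp only [slab, Set.mem_ofPred_eq, place_same]
  rw [div_lt_div_iff_of_pos_right hp, div_lt_div_iff_of_pos_right hp]
  constructor <;> linarith

theorem slab_disjoint {i : Fin d} {j j' : Fin p} {x : Fin d → ℝ} (h : x ∈ slab p i j)
    (h' : x ∈ slab p i j') : j = j' := by
  have hp := cast_pos_of_fin j
  have h1 := h.1.trans h'.2
  have h2 := h'.1.trans h.2
  rw [div_lt_div_iff_of_pos_right hp] at h1 h2
  have h1' : (j : ℕ) < j' + 1 := by exact_mod_cast h1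
  have h2' : (j' : ℕ) < j + 1 := by exact_mod_cast h2
  exact Fin.ext (by omega)

/-! ### Families of regions of the cube -/

/-- All members of the family are nondegenerate rectangles inside the cube. -/
def IsFamily (D : Set (Set (Fin d → ℝ))) : Prop :=
  ∀ R ∈ D, (∃ a b : Fin d → ℝ, (∀ k, a k < b k) ∧ R = rect a b) ∧ R ⊆ cube d

theorem IsFamily.nonempty {D : Set (Set (Fin d → ℝ))} (h : IsFamily D) {R : Set (Fin d → ℝ)}
    (hR : R ∈ D) : R.Nonempty := by
  obtain ⟨⟨a, b, hab, rfl⟩, -⟩ := h R hR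
  exact rect_nonempty hab

theorem isFamily_cube : IsFamily {cube d} := by
  rintro R rfl
  exact ⟨⟨_, _, fun _ => zero_lt_one, rfl⟩, subset_rfl⟩

theorem isFamily_join {i : Fin d} {E : Fin p → Set (Set (Fin d → ℝ))} (h : ∀ j, IsFamily (E j)) :
    IsFamily (join i E) := by
  intro R hR
  obtain ⟨j, S, hS, rfl⟩ := mem_join.1 hR
  obtain ⟨⟨a, b, hab, rfl⟩, hc⟩ := h j S hS
  refine ⟨⟨_, _, fun k => (place_lt_iff i j a b k).2 (hab k), image_place_rect i j a b⟩, ?_⟩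
  rintro _ ⟨x, hx, rfl⟩
  exact place_mem_cube (hc hx)

theorem isFamily_decomp (T : PTree d p) : IsFamily T.decomp := by
  induction T with
  | leaf => exact isFamily_cube
  | node i c ih => exact isFamily_join ih

theorem image_place_subset_slab {i : Fin d} {j : Fin p} {R : Set (Fin d → ℝ)} (h : R ⊆ cube d) :
    place i j '' R ⊆ slab p i j := by
  rintro _ ⟨x, hx, rfl⟩
  exact place_mem_slab (h hx)

/-- The slabs are pairwise disjoint, so one point of the common image determines `j`. This is why
families are required to have nonempty members inside the cube. -/
theorem eq_of_image_place_eq {i : Fin d} {j j' : Fin p} {R R' : Set (Fin d → ℝ)}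
    (hne : R.Nonempty) (hR : R ⊆ cube d) (hR' : R' ⊆ cube d)
    (h : place i j '' R = place i j' '' R') : j = j' ∧ R = R' := by
  obtain ⟨x, hx⟩ := hne
  have h1 := image_place_subset_slab (j := j) (i := i) hR (Set.mem_image_of_mem _ hx)
  have h2 := image_place_subset_slab (j := j') (i := i) hR' (h ▸ Set.mem_image_of_mem _ hx)
  obtain rfl := slab_disjoint h1 h2
  exact ⟨rfl, image_place_injective i j h⟩

theorem image_place_mem_join {i : Fin d} {E : Fin p → Set (Set (Fin d → ℝ))}
    (h : ∀ j, IsFamily (E j)) {j : Fin p} {R : Set (Fin d → ℝ)} (hne : R.Nonempty)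
    (hR : R ⊆ cube d) : place i j '' R ∈ join i E ↔ R ∈ E j := by
  rw [mem_join]
  constructor
  · rintro ⟨j', S, hS, he⟩
    obtain ⟨rfl, rfl⟩ := eq_of_image_place_eq ((h j').nonempty hS) ((h j' S hS).2) hR he
    exact hS
  · exact fun hR => ⟨j, R, hR, rfl⟩

theorem join_injective {i : Fin d} {E E' : Fin p → Set (Set (Fin d → ℝ))}
    (h : ∀ j, IsFamily (E j)) (h' : ∀ j, IsFamily (E' j)) (he : join i E = join i E') :
    E = E' := by
  funext j
  ext R
  constructor
  · intro hR
    rw [← image_place_mem_join (i := i) h' ((h j).nonempty hR) (h j R hR).2, ← he]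
    exact mem_join.2 ⟨j, R, hR, rfl⟩
  · intro hR
    rw [← image_place_mem_join (i := i) h ((h' j).nonempty hR) (h' j R hR).2, he]
    exact mem_join.2 ⟨j, R, hR, rfl⟩

/-- The interchange itself: two full layers of cuts along different axes may be made in either
order. -/
theorem join_comm {i k : Fin d} (hki : k ≠ i) (E : Fin p → Fin p → Set (Set (Fin d → ℝ))) :
    (join k fun l => join i fun j => E j l) = join i fun j => join k fun l => E j l := by
  have hc : ∀ (j l : Fin p) (S : Set (Fin d → ℝ)),
      place k l '' (place i j '' S) = place i j '' (place k l '' S) := by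
    intro j l S
    rw [Set.image_image, Set.image_image]
    simp_rw [place_comm hki]
  ext R
  simp only [mem_join]
  constructor
  · rintro ⟨l, _, ⟨j, S, hS, rfl⟩, rfl⟩
    exact ⟨j, _, ⟨l, S, hS, rfl⟩, (hc j l S).symm⟩
  · rintro ⟨j, _, ⟨l, S, hS, rfl⟩, rfl⟩
    exact ⟨l, _, ⟨j, S, hS, rfl⟩, hc j l S⟩

/-! ### Number of regions -/

theorem finite_join {i : Fin d} {E : Fin p → Set (Set (Fin d → ℝ))} (h : ∀ j, (E j).Finite) :
    (join i E).Finite :=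
  Set.finite_iUnion fun j => (h j).image _

theorem ncard_join {i : Fin d} {E : Fin p → Set (Set (Fin d → ℝ))}
    (h : ∀ j, IsFamily (E j)) (hf : ∀ j, (E j).Finite) :
    (join i E).ncard = ∑ j, (E j).ncard := by
  rw [join, Set.ncard_iUnion_of_finite (fun j => (hf j).image _), finsum_eq_sum_of_fintype]
  · exact Finset.sum_congr rfl fun j _ => Set.ncard_image_of_injective _ (image_place_injective i j)
  · intro j j' hjj
    rw [Function.onFun, Set.disjoint_left]
    rintro _ ⟨R, hR, rfl⟩ ⟨R', hR', he⟩
    exact hjj (eq_of_image_place_eq ((h j').nonempty hR') (h j' _ hR').2 (h j _ hR).2 he).1.symm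

theorem finite_decomp (T : PTree d p) : T.decomp.Finite := by
  induction T with
  | leaf => exact Set.finite_singleton _
  | node i c ih => exact finite_join ih

theorem ncard_decomp (T : PTree d p) : T.decomp.ncard = T.leaves := by
  induction T with
  | leaf => exact Set.ncard_singleton _
  | node i c ih =>
    rw [decomp_node, ncard_join (fun j => isFamily_decomp _) fun j => finite_decomp _]
    exact Finset.sum_congr rfl fun j _ => ih j

theorem leaves_eq_of_decomp_eq {T T' : PTree d p} (h : T.decomp = T'.decomp) :
    T.leaves = T'.leaves := by
  rw [← ncard_decomp, ← ncard_decomp, h]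

theorem leaves_pos (hp : 0 < p) (T : PTree d p) : 0 < T.leaves := by
  induction T with
  | leaf => exact one_pos
  | node i c ih => exact Finset.sum_pos (fun j _ => ih j) ⟨⟨0, hp⟩, Finset.mem_univ _⟩

theorem leaves_child_lt (hp : 2 ≤ p) (i : Fin d) (c : Fin p → PTree d p) (j : Fin p) :
    (c j).leaves < (PTree.node i c).leaves := by
  have : Nontrivial (Fin p) := Fin.nontrivial_iff_two_le.2 hp
  obtain ⟨j', hj'⟩ := exists_ne j
  exact Finset.single_lt_sum (f := fun j => (c j).leaves) hj' (Finset.mem_univ _)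
    (Finset.mem_univ _)
    (leaves_pos (zero_lt_two.trans_le hp) _) fun _ _ _ => Nat.zero_le _

theorem one_lt_leaves_node (hp : 2 ≤ p) (i : Fin d) (c : Fin p → PTree d p) :
    1 < (PTree.node i c).leaves :=
  lt_of_le_of_lt (leaves_pos (by omega) (c ⟨0, by omega⟩)) (leaves_child_lt hp i c _)

theorem finite_trees_leaves_le (hp : 2 ≤ p) (n : ℕ) : {T : PTree d p | T.leaves ≤ n}.Finite := by
  induction n with
  | zero =>
    convert Set.finite_empty
    ext T
    simpa using (leaves_pos (by omega) T).ne'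
  | succ n ih =>
    have h2 : (Set.univ ×ˢ Set.univ.pi fun _ : Fin p => {T : PTree d p | T.leaves ≤ n} :
        Set (Fin d × (Fin p → PTree d p))).Finite :=
      Set.finite_univ.prod (Set.Finite.pi fun _ => ih)
    refine ((Set.finite_singleton PTree.leaf).union
      (h2.image fun q => PTree.node q.1 q.2)).subset ?_
    rintro (_ | ⟨i, c⟩) hT
    · exact Or.inl rfl
    · refine Or.inr ⟨(i, c), ⟨Set.mem_univ _, fun j _ => ?_⟩, rfl⟩
      have := leaves_child_lt hp i c j
      simp only [Set.mem_ofPred_eq] at hT ⊢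
      omega

/-! ### Possible root labels of a decomposition -/

/-- Some tree with root label `i` describes `D`. -/
def HasRoot (p : ℕ) (i : Fin d) (D : Set (Set (Fin d → ℝ))) : Prop :=
  ∃ c : Fin p → PTree d p, PTree.decomp (.node i c) = D

theorem HasRoot.subset_slab {i : Fin d} {D : Set (Set (Fin d → ℝ))} (h : HasRoot p i D) :
    ∀ R ∈ D, ∃ j, R ⊆ slab p i j := by
  obtain ⟨c, rfl⟩ := h
  intro R hR
  obtain ⟨j, S, hS, rfl⟩ := mem_join.1 hR
  exact ⟨j, image_place_subset_slab (isFamily_decomp _ S hS).2⟩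

theorem not_cube_subset_slab (hp : 2 ≤ p) (i : Fin d) (j : Fin p) : ¬ cube d ⊆ slab p i j := by
  intro h
  have hp0 := cast_pos_of_fin j
  -- A wall of the slab that meets the cube supplies the missing point: the upper wall for the first
  -- slab, the lower wall otherwise.
  rcases Nat.eq_zero_or_pos (j : ℕ) with h0 | h0
  · have hp1 : (1 : ℝ) < p := by exact_mod_cast hp
    have hm : (fun _ => 1 / (p : ℝ)) ∈ cube d := fun k =>
      ⟨div_pos one_pos hp0, (div_lt_one hp0).2 hp1⟩
    have := (h hm).2
    simp [h0] at this
  · have hj0 : (0 : ℝ) < ((j : ℕ) : ℝ) := by exact_mod_cast h0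
    have hj : ((j : ℕ) : ℝ) < p := by exact_mod_cast j.isLt
    have hm : (fun _ => ((j : ℕ) : ℝ) / (p : ℝ)) ∈ cube d := fun k =>
      ⟨div_pos hj0 hp0, (div_lt_one hp0).2 hj⟩
    exact lt_irrefl _ (h hm).1

theorem subset_slab_of_image {i k : Fin d} (hki : k ≠ i) {j l : Fin p} {R : Set (Fin d → ℝ)}
    (h : place i j '' R ⊆ slab p k l) : R ⊆ slab p k l := by
  intro x hx
  have := h (Set.mem_image_of_mem _ hx)
  simpa only [slab, Set.mem_ofPred_eq, place_ne hki] using this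

theorem HasRoot.join {i k : Fin d} (hki : k ≠ i) {E : Fin p → Set (Set (Fin d → ℝ))}
    (h : ∀ j, HasRoot p k (E j)) : HasRoot p k (join i E) := by
  choose c hc using h
  refine ⟨fun l => .node i fun j => c j l, ?_⟩
  simp only [decomp_node]
  rw [join_comm hki fun j l => (c j l).decomp]
  exact congrArg _ (funext hc)

/-- Converse of `HasRoot.subset_slab`, making the possible root labels a geometric property of the
decomposition. At a node with label `i ≠ k`, `place i` leaves coordinate `k` alone, so the slab
condition descends to the children; cuts along `k` found in all of them are then interchanged with
the root cut. -/
theorem hasRoot_of_subset_slab (hp : 2 ≤ p) {k : Fin d} (T : PTree d p)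
    (h : ∀ R ∈ T.decomp, ∃ j, R ⊆ slab p k j) : HasRoot p k T.decomp := by
  induction T with
  | leaf =>
    obtain ⟨j, hj⟩ := h (cube d) rfl
    exact absurd hj (not_cube_subset_slab hp k j)
  | node i c ih =>
    by_cases hki : k = i
    · subst hki
      exact ⟨c, rfl⟩
    · refine HasRoot.join hki fun j => ih j fun R hR => ?_
      obtain ⟨l, hl⟩ := h _ (mem_join.2 ⟨j, R, hR, rfl⟩)
      exact ⟨l, subset_slab_of_image hki hl⟩

theorem hasRoot_decomp_node_iff (hp : 2 ≤ p) {i k : Fin d} (hki : k ≠ i)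
    (c : Fin p → PTree d p) :
    HasRoot p k (PTree.decomp (.node i c)) ↔ ∀ j, HasRoot p k (c j).decomp := by
  refine ⟨fun h j => hasRoot_of_subset_slab hp _ fun R hR => ?_, fun h => HasRoot.join hki h⟩
  obtain ⟨l, hl⟩ := h.subset_slab _ (mem_join.2 ⟨j, R, hR, rfl⟩)
  exact ⟨l, subset_slab_of_image hki hl⟩

theorem not_hasRoot_leaf (hp : 2 ≤ p) (i : Fin d) :
    ¬ HasRoot p i (PTree.leaf : PTree d p).decomp := by
  rintro ⟨c, hc⟩
  have := leaves_eq_of_decomp_eq hc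
  exact (one_lt_leaves_node hp i c).ne' this

/-! ### Interchange maximal trees -/

theorem interchangeMaximal_leaf : (PTree.leaf : PTree d p).InterchangeMaximal := by
  rintro ⟨i, c, h, -⟩
  cases h

theorem interchangeMaximal_node_iff {i : Fin d} {c : Fin p → PTree d p} :
    (PTree.node i c).InterchangeMaximal ↔
      (∀ j, (c j).InterchangeMaximal) ∧
        ∀ k, i < k → ¬ HasRoot p k (PTree.decomp (.node i c)) := by
  constructor
  · refine fun h => ⟨fun j => ?_, fun k hk => ?_⟩
    · rintro ⟨i', c', hs, hr⟩
      exact h ⟨i', c', .child i c j hs, hr⟩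
    · rintro ⟨c', hc'⟩
      exact h ⟨i, c, .refl, k, c', hk, hc'⟩
  · rintro ⟨h1, h2⟩ ⟨i', c', hs, k, c'', hk, he⟩
    cases hs with
    | refl => exact h2 k hk ⟨c'', he⟩
    | child _ _ j hs => exact h1 j ⟨i', c', hs, k, c'', hk, he⟩

/-- Choose the largest possible root label, then recurse. The new children need not be subtrees of
`T`, so the induction is on the number of leaves, which depends only on the decomposition. -/
theorem exists_interchangeMaximal (hp : 2 ≤ p) (T : PTree d p) :
    ∃ T' : PTree d p, T'.InterchangeMaximal ∧ T'.decomp = T.decomp := by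
  induction hn : T.leaves using Nat.strong_induction_on generalizing T with
  | _ n ih =>
    cases T with
    | leaf => exact ⟨.leaf, interchangeMaximal_leaf, rfl⟩
    | node i c =>
      obtain ⟨k, hk⟩ := Set.Finite.exists_maximal
        (Set.toFinite {k | HasRoot p k (PTree.decomp (.node i c))}) ⟨i, c, rfl⟩
      obtain ⟨c', hc'⟩ := hk.prop
      have hl := leaves_eq_of_decomp_eq hc'
      choose c'' h1 h2 using fun j =>
        ih _ (hn ▸ hl ▸ leaves_child_lt hp k c' j) (c' j) rfl
      have he : PTree.decomp (.node k c'') = PTree.decomp (.node i c) := by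
        rw [← hc', decomp_node, decomp_node]
        exact congrArg _ (funext h2)
      refine ⟨.node k c'', interchangeMaximal_node_iff.2 ⟨h1, fun m hm hr => ?_⟩, he⟩
      rw [he] at hr
      exact hm.not_ge (hk.le_of_ge hr hm.le)

/-- Maximality forces the root label to be the largest possible one, and `join_injective` then
recovers the decompositions of the children. -/
theorem InterchangeMaximal.decomp_injective (hp : 2 ≤ p) {T T' : PTree d p}
    (h : T.InterchangeMaximal) (h' : T'.InterchangeMaximal) (he : T.decomp = T'.decomp) :
    T = T' := by
  induction T generalizing T' with
  | leaf =>
    cases T' with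
    | leaf => rfl
    | node i c => exact absurd ⟨c, he.symm⟩ (not_hasRoot_leaf hp i)
  | node i c ih =>
    cases T' with
    | leaf => exact absurd ⟨c, he⟩ (not_hasRoot_leaf hp i)
    | node i' c' =>
      obtain ⟨h1, h2⟩ := interchangeMaximal_node_iff.1 h
      obtain ⟨h1', h2'⟩ := interchangeMaximal_node_iff.1 h'
      obtain rfl : i = i' := le_antisymm
        (not_lt.1 fun hlt => h2' i hlt ⟨c, he⟩) (not_lt.1 fun hlt => h2 i' hlt ⟨c', he.symm⟩)
      have hc := join_injective (fun j => isFamily_decomp _) (fun j => isFamily_decomp _) he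
      exact congrArg _ (funext fun j => ih j (h1 j) (h1' j) (congrFun hc j))

/-! ### Generating functions -/

/-- Powers of the generating function of a set with finite fibres of a weight function count
tuples by total weight. -/
theorem mk_ncard_pow {α : Type*} (A : Set α) (w : α → ℕ)
    (hf : ∀ n, {a | a ∈ A ∧ w a = n}.Finite) (p : ℕ) :
    (PowerSeries.mk fun n => ({a | a ∈ A ∧ w a = n}.ncard : ℤ)) ^ p =
      PowerSeries.mk fun n =>
        ({f : Fin p → α | (∀ j, f j ∈ A) ∧ ∑ j, w (f j) = n}.ncard : ℤ) := by
  classical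
  ext n
  -- Tuples are grouped by their vector `l` of weights, matching the expansion of the coefficient of
  -- a product.
  have hset : {f : Fin p → α | (∀ j, f j ∈ A) ∧ ∑ j, w (f j) = n} =
      ((Finset.finsuppAntidiag Finset.univ n).biUnion fun l : Fin p →₀ ℕ =>
        Fintype.piFinset fun j => (hf (l j)).toFinset : Finset (Fin p → α)) := by
    ext f
    simp only [Set.mem_ofPred_eq, Finset.mem_coe, Finset.mem_biUnion, Finset.mem_finsuppAntidiag,
      Fintype.mem_piFinset, Set.Finite.mem_toFinset]
    constructor
    · rintro ⟨h1, h2⟩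
      exact ⟨Finsupp.equivFunOnFinite.symm fun j => w (f j), ⟨h2, Finset.subset_univ _⟩,
        fun j => ⟨h1 j, rfl⟩⟩
    · rintro ⟨l, ⟨h1, -⟩, h2⟩
      exact ⟨fun j => (h2 j).1, h1 ▸ Finset.sum_congr rfl fun j _ => (h2 j).2⟩
  have hpow := Finset.prod_const (s := (Finset.univ : Finset (Fin p)))
    (PowerSeries.mk fun n => ({a | a ∈ A ∧ w a = n}.ncard : ℤ))
  rw [Finset.card_univ, Fintype.card_fin] at hpow
  rw [← hpow, PowerSeries.coeff_prod, PowerSeries.coeff_mk, hset, Set.ncard_coe_finset,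
    Finset.card_biUnion]
  · push_cast
    refine Finset.sum_congr rfl fun l _ => ?_
    rw [Fintype.card_piFinset]
    push_cast
    refine Finset.prod_congr rfl fun j _ => ?_
    rw [PowerSeries.coeff_mk, Set.ncard_eq_toFinset_card _ (hf (l j))]
  · intro l _ l' _ hne
    rw [Function.onFun, Finset.disjoint_left]
    intro f hl hl'
    refine hne (Finsupp.ext fun j => ?_)
    have h1 := Fintype.mem_piFinset.1 hl j
    have h2 := Fintype.mem_piFinset.1 hl' j
    rw [Set.Finite.mem_toFinset] at h1 h2
    exact h1.2.symm.trans h2.2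

/-- The decompositions described by trees for which all elements of `S` are possible root
labels. -/
def withRoots (p : ℕ) (S : Finset (Fin d)) : Set (Set (Set (Fin d → ℝ))) :=
  {D | (∃ T : PTree d p, T.decomp = D) ∧ ∀ i ∈ S, HasRoot p i D}

/-- The generating function of `withRoots p S` by number of regions. -/
def rootSeries (p : ℕ) (S : Finset (Fin d)) : PowerSeries ℤ :=
  PowerSeries.mk fun n => ({D | D ∈ withRoots p S ∧ D.ncard = n}.ncard : ℤ)

theorem finite_withRoots (hp : 2 ≤ p) (S : Finset (Fin d)) (n : ℕ) :
    {D | D ∈ withRoots p S ∧ D.ncard = n}.Finite := by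
  refine ((finite_trees_leaves_le hp n).image PTree.decomp).subset ?_
  rintro D ⟨⟨⟨T, rfl⟩, -⟩, hn⟩
  rw [ncard_decomp] at hn
  exact ⟨T, hn.le, rfl⟩

theorem withRoots_insert (hp : 2 ≤ p) {S : Finset (Fin d)} {i : Fin d} (hi : i ∉ S) (n : ℕ) :
    {D | D ∈ withRoots p (insert i S) ∧ D.ncard = n} =
      join i '' {E : Fin p → Set (Set (Fin d → ℝ)) |
        (∀ j, E j ∈ withRoots p S) ∧ ∑ j, (E j).ncard = n} := by
  ext D
  constructor
  · rintro ⟨⟨-, h⟩, rfl⟩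
    obtain ⟨c, rfl⟩ := h i (Finset.mem_insert_self i S)
    refine ⟨fun j => (c j).decomp, ⟨fun j => ⟨⟨c j, rfl⟩, fun k hk => ?_⟩, ?_⟩, rfl⟩
    · exact (hasRoot_decomp_node_iff hp (ne_of_mem_of_not_mem hk hi) c).1
        (h k (Finset.mem_insert_of_mem hk)) j
    · exact (ncard_join (fun j => isFamily_decomp _) fun j => finite_decomp _).symm
  · rintro ⟨E, ⟨hE, hn⟩, rfl⟩
    choose c hc using fun j => (hE j).1
    obtain rfl : (fun j => (c j).decomp) = E := funext hc
    refine ⟨⟨⟨.node i c, rfl⟩, fun k hk => ?_⟩, ?_⟩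
    · rcases Finset.mem_insert.1 hk with rfl | hk
      · exact ⟨c, rfl⟩
      · exact HasRoot.join (ne_of_mem_of_not_mem hk hi) fun j => (hE j).2 k hk
    · rw [ncard_join (fun j => isFamily_decomp _) fun j => finite_decomp _, hn]

theorem rootSeries_insert (hp : 2 ≤ p) {S : Finset (Fin d)} {i : Fin d} (hi : i ∉ S) :
    rootSeries p (insert i S) = rootSeries p S ^ p := by
  rw [rootSeries, rootSeries, mk_ncard_pow _ _ (finite_withRoots hp S)]
  ext n
  rw [PowerSeries.coeff_mk, PowerSeries.coeff_mk, withRoots_insert hp hi, Set.InjOn.ncard_image]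
  have hfam : ∀ D ∈ withRoots p S, IsFamily D := by
    rintro D ⟨⟨T, rfl⟩, -⟩
    exact isFamily_decomp T
  exact fun E hE E' hE' he =>
    join_injective (fun j => hfam _ (hE.1 j)) (fun j => hfam _ (hE'.1 j)) he

theorem rootSeries_eq_pow (hp : 2 ≤ p) (S : Finset (Fin d)) :
    rootSeries p S = rootSeries p (∅ : Finset (Fin d)) ^ p ^ S.card := by
  induction S using Finset.induction_on with
  | empty => simp
  | insert i S hi ih => rw [rootSeries_insert hp hi, ih, Finset.card_insert_of_notMem hi, pow_succ,
      pow_mul]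

/-- Inclusion–exclusion, after exchanging the sums over `S` and over decompositions: only one with
no possible root label survives. -/
theorem alternating_sum_rootSeries (hp : 2 ≤ p) :
    ∑ S : Finset (Fin d), (-1) ^ S.card * rootSeries p S = PowerSeries.X := by
  classical
  ext n
  set F := (finite_withRoots hp (∅ : Finset (Fin d)) n).toFinset with hF
  have hmem : ∀ D, D ∈ F ↔ (∃ T : PTree d p, T.decomp = D) ∧ D.ncard = n := by
    intro D
    simp [hF, withRoots]
  have hcard : ∀ S : Finset (Fin d), PowerSeries.coeff n (rootSeries p S) =
      ∑ D ∈ F, if S ⊆ Finset.univ.filter (fun i => HasRoot p i D) then (1 : ℤ) else 0 := by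
    intro S
    rw [rootSeries, PowerSeries.coeff_mk, ← Finset.sum_filter, Finset.sum_const, nsmul_one,
      ← Set.ncard_coe_finset]
    congr 2
    ext D
    simp only [Finset.coe_filter, Set.mem_ofPred_eq, hmem, withRoots, Finset.subset_iff,
      Finset.mem_filter, Finset.mem_univ, true_and]
    tauto
  have hterm : ∀ S : Finset (Fin d), PowerSeries.coeff n ((-1) ^ S.card * rootSeries p S) =
      ∑ D ∈ F, if S ⊆ Finset.univ.filter (fun i => HasRoot p i D) then (-1 : ℤ) ^ S.card
        else 0 := by
    intro S
    have h1 : ((-1) ^ S.card : PowerSeries ℤ) = PowerSeries.C ((-1) ^ S.card) := by simp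
    rw [h1, PowerSeries.coeff_C_mul, hcard, Finset.mul_sum]
    exact Finset.sum_congr rfl fun D _ => by rw [mul_ite, mul_one, mul_zero]
  have hinner : ∀ D ∈ F, (∑ S : Finset (Fin d),
      if S ⊆ Finset.univ.filter (fun i => HasRoot p i D) then (-1 : ℤ) ^ S.card else 0) =
      if D = {cube d} then 1 else 0 := by
    intro D hD
    rw [← Finset.sum_filter]
    have : (Finset.univ.filter fun S : Finset (Fin d) =>
        S ⊆ Finset.univ.filter fun i => HasRoot p i D) =
        (Finset.univ.filter fun i => HasRoot p i D).powerset := by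
      ext S
      simp
    rw [this, Finset.sum_powerset_neg_one_pow_card]
    obtain ⟨⟨T, rfl⟩, -⟩ := (hmem D).1 hD
    refine if_congr ?_ rfl rfl
    rw [Finset.filter_eq_empty_iff]
    cases T with
    | leaf => exact ⟨fun _ => rfl, fun _ i _ => not_hasRoot_leaf hp i⟩
    | node i c =>
      exact ⟨fun h => absurd ⟨c, rfl⟩ (h (Finset.mem_univ i)),
        fun h => absurd ⟨c, h⟩ (not_hasRoot_leaf hp i)⟩
  rw [map_sum, Finset.sum_congr rfl fun S _ => hterm S, Finset.sum_comm,
    Finset.sum_congr rfl hinner, Finset.sum_ite_eq', PowerSeries.coeff_X]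
  refine if_congr ?_ rfl rfl
  rw [hmem, Set.ncard_singleton]
  exact ⟨fun h => h.2.symm, fun h => ⟨⟨.leaf, rfl⟩, h.symm⟩⟩

theorem sum_choose_mul_rootSeries_pow (hp : 2 ≤ p) :
    ∑ i ∈ Finset.range (d + 1), (-1 : PowerSeries ℤ) ^ i * (d.choose i : PowerSeries ℤ) *
      rootSeries p (∅ : Finset (Fin d)) ^ p ^ i = PowerSeries.X := by
  rw [← alternating_sum_rootSeries (d := d) hp, ← Finset.powerset_univ,
    Finset.sum_powerset, Finset.card_univ, Fintype.card_fin]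
  refine Finset.sum_congr rfl fun i _ => ?_
  rw [Finset.sum_congr rfl fun S hS => by
    rw [rootSeries_eq_pow hp S, (Finset.mem_powersetCard.1 hS).2]]
  rw [Finset.sum_const, Finset.card_powersetCard, Finset.card_univ, Fintype.card_fin,
    nsmul_eq_mul]
  ring

/-! ### Successive slicing and trees -/

/-- Affine maps preserve interpolation. The updated corner `a'` is kept separate from `a` so that
the lemma serves both corners of a slice. -/
theorem place_update_lerp (k i : Fin d) (j : Fin p) (a a' b : Fin d → ℝ) (t : ℝ) :
    place k j (Function.update a' i (a i + t * (b i - a i))) =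
      Function.update (place k j a') i
        (place k j a i + t * (place k j b i - place k j a i)) := by
  ext m
  by_cases hmi : m = i
  · subst hmi
    by_cases hmk : m = k
    · subst hmk
      simp only [place_same, Function.update_self]
      ring
    · simp only [place_ne hmk, Function.update_self]
  · rw [Function.update_of_ne hmi]
    by_cases hmk : m = k
    · subst hmk
      rw [place_same, place_same, Function.update_of_ne hmi]
    · rw [place_ne hmk, place_ne hmk, Function.update_of_ne hmi]

theorem image_place_slices (k i : Fin d) (j : Fin p) (a b : Fin d → ℝ) :
    (fun R => place k j '' R) '' slices p i a b = slices p i (place k j a) (place k j b) := by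
  rw [slices, slices, ← Set.range_comp]
  congr 1
  ext1 l
  simp only [Function.comp_apply, image_place_rect, place_update_lerp]

theorem slices_cube (p : ℕ) (i : Fin d) :
    slices p i (fun _ => 0) (fun _ => 1) = join i fun _ : Fin p => {cube d} := by
  ext R
  rw [mem_join]
  simp only [slices, Set.mem_range, Set.mem_singleton_iff, exists_eq_left, cube, image_place_rect,
    place]
  refine exists_congr fun j => ?_
  norm_num [add_comm]

theorem join_update_refine {k : Fin d} {E : Fin p → Set (Set (Fin d → ℝ))}
    (hE : ∀ j, IsFamily (E j)) {j : Fin p} {S : Set (Fin d → ℝ)} (hS : S ∈ E j)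
    (Y : Set (Set (Fin d → ℝ))) :
    join k (Function.update E j (E j \ {S} ∪ Y)) =
      (join k E \ {place k j '' S}) ∪ (fun R => place k j '' R) '' Y := by
  ext R
  constructor
  · intro hR
    obtain ⟨l, U, hU, rfl⟩ := mem_join.1 hR
    by_cases hl : l = j
    · subst hl
      rw [Function.update_self] at hU
      rcases hU with ⟨hU, hne⟩ | hU
      · exact Or.inl ⟨mem_join.2 ⟨l, U, hU, rfl⟩, fun h => hne (image_place_injective k l h)⟩
      · exact Or.inr ⟨U, hU, rfl⟩
    · rw [Function.update_of_ne hl] at hU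
      exact Or.inl ⟨mem_join.2 ⟨l, U, hU, rfl⟩, fun h =>
        hl (eq_of_image_place_eq ((hE l).nonempty hU) (hE l U hU).2 (hE j S hS).2 h).1⟩
  · rintro (⟨hR, hne⟩ | ⟨U, hU, rfl⟩)
    · obtain ⟨l, U, hU, rfl⟩ := mem_join.1 hR
      refine mem_join.2 ⟨l, U, ?_, rfl⟩
      by_cases hl : l = j
      · subst hl
        rw [Function.update_self]
        refine Or.inl ⟨hU, fun h => hne ?_⟩
        rw [Set.mem_singleton_iff.1 h]
        rfl
      · rwa [Function.update_of_ne hl]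
    · exact mem_join.2 ⟨j, U, by rw [Function.update_self]; exact Or.inr hU, rfl⟩

/-- The rectangle is a leaf of the tree, and slicing it grafts a node with `p` leaves there. The
corners are generalized because descending to a child pulls them back along `place`. -/
theorem exists_tree_refine (i : Fin d) (hp : 2 ≤ p) (T : PTree d p) (a b : Fin d → ℝ)
    (hab : ∀ k, a k < b k) (h : rect a b ∈ T.decomp) :
    ∃ T' : PTree d p, T'.leaves = T.leaves + (p - 1) ∧
      T'.decomp = (T.decomp \ {rect a b}) ∪ slices p i a b := by
  induction T generalizing a b with
  | leaf =>
    obtain ⟨rfl, rfl⟩ := rect_inj hab (fun _ => zero_lt_one) h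
    refine ⟨.node i fun _ => .leaf, ?_, ?_⟩
    · simp only [PTree.leaves, Finset.sum_const, Finset.card_univ, Fintype.card_fin, smul_eq_mul]
      omega
    · rw [slices_cube, decomp_node]
      change _ = {cube d} \ {cube d} ∪ _
      rw [Set.sdiff_self, Set.empty_union]
      rfl
  | node k c ih =>
    obtain ⟨j, S, hS, he⟩ := mem_join.1 h
    obtain ⟨⟨a', b', hab', rfl⟩, -⟩ := isFamily_decomp _ S hS
    rw [image_place_rect] at he
    obtain ⟨rfl, rfl⟩ := rect_inj (fun m => (place_lt_iff k j a' b' m).2 (hab' m)) hab he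
    obtain ⟨T', hl, hT'⟩ := ih j a' b' hab' hS
    refine ⟨.node k (Function.update c j T'), ?_, ?_⟩
    · simp only [PTree.leaves]
      rw [← Finset.add_sum_erase _ _ (Finset.mem_univ j),
        ← Finset.add_sum_erase _ (fun l => (c l).leaves) (Finset.mem_univ j),
        Function.update_self, hl,
        Finset.sum_congr rfl fun l hl => by rw [Function.update_of_ne (Finset.ne_of_mem_erase hl)]]
      ring
    · have hup : (fun l => (Function.update c j T' l).decomp) =
          Function.update (fun l => (c l).decomp) j
            ((c j).decomp \ {rect a' b'} ∪ slices p i a' b') := by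
        rw [← hT']
        exact Function.comp_update PTree.decomp c j T'
      rw [decomp_node, hup, join_update_refine (fun l => isFamily_decomp _) hS,
        image_place_slices, image_place_rect, decomp_node]

theorem IsDecomp.exists_tree (hp : 2 ≤ p) {m : ℕ} {D : Set (Set (Fin d → ℝ))}
    (h : IsDecomp p m D) : ∃ T : PTree d p, T.leaves = 1 + m * (p - 1) ∧ T.decomp = D := by
  induction h with
  | zero => exact ⟨.leaf, by simp [PTree.leaves], rfl⟩
  | step a b i _ hab hR ih =>
    obtain ⟨T, hl, rfl⟩ := ih
    obtain ⟨T', hl', hT'⟩ := exists_tree_refine i hp T a b hab hR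
    exact ⟨T', by rw [hl', hl]; ring, hT'⟩

/-- The slicing steps that build `D` are replayed inside slab `j` while the other slabs stay fixed.
-/
theorem IsDecomp.join_update (hp : 2 ≤ p) {k : Fin d} {E : Fin p → Set (Set (Fin d → ℝ))}
    (hE : ∀ j, IsFamily (E j)) {j : Fin p} {m₀ m : ℕ} {D : Set (Set (Fin d → ℝ))}
    (h₀ : IsDecomp p m₀ (join k (Function.update E j {cube d}))) (h : IsDecomp p m D) :
    IsDecomp p (m₀ + m) (join k (Function.update E j D)) := by
  induction h with
  | zero => exact h₀
  | @step m D a b i hD hab hR ih =>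
    obtain ⟨T, -, rfl⟩ := hD.exists_tree hp
    have hfam : ∀ l, IsFamily (Function.update E j T.decomp l) := by
      intro l
      by_cases hl : l = j
      · subst hl
        rw [Function.update_self]
        exact isFamily_decomp T
      · rw [Function.update_of_ne hl]
        exact hE l
    have key := join_update_refine (k := k) hfam (j := j) (S := rect a b)
      (by rwa [Function.update_self]) (slices p i a b)
    rw [Function.update_self, Function.update_idem, image_place_slices, image_place_rect] at key
    rw [key]
    refine IsDecomp.step _ _ i ih (fun l => (place_lt_iff k j a b l).2 (hab l)) ?_
    rw [← image_place_rect]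
    exact mem_join.2 ⟨j, _, by rwa [Function.update_self], rfl⟩

theorem exists_isDecomp (hp : 2 ≤ p) (T : PTree d p) :
    ∃ m, T.leaves = 1 + m * (p - 1) ∧ IsDecomp p m T.decomp := by
  induction T with
  | leaf => exact ⟨0, by simp [PTree.leaves], .zero⟩
  | node i c ih =>
    classical
    choose m hm hD using ih
    -- The slabs are filled one at a time; the summand `1` counts the root cut.
    have key : ∀ s : Finset (Fin p), IsDecomp p (1 + ∑ j ∈ s, m j)
        (join i fun j => if j ∈ s then (c j).decomp else {cube d}) := by
      intro s
      induction s using Finset.induction_on with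
      | empty =>
        have := IsDecomp.step (p := p) _ _ i IsDecomp.zero (fun _ => zero_lt_one)
          (Set.mem_singleton (cube d))
        rw [slices_cube] at this
        change IsDecomp p (0 + 1) ({cube d} \ {cube d} ∪ _) at this
        rw [Set.sdiff_self, Set.empty_union] at this
        simpa using this
      | insert j s hj ih =>
        have hfam : ∀ l, IsFamily (if l ∈ s then (c l).decomp else {cube d}) := by
          intro l
          split_ifs
          exacts [isFamily_decomp _, isFamily_cube]
        have h0 : Function.update (fun l => if l ∈ s then (c l).decomp else {cube d}) j
            {cube d} = fun l => if l ∈ s then (c l).decomp else {cube d} := by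
          rw [Function.update_eq_self_iff, if_neg hj]
        have h1 : Function.update (fun l => if l ∈ s then (c l).decomp else {cube d}) j
            (c j).decomp = fun l => if l ∈ insert j s then (c l).decomp else {cube d} := by
          funext l
          by_cases hl : l = j
          · subst hl
            simp
          · simp [hl]
        have := IsDecomp.join_update hp hfam (by rw [h0]; exact ih) (hD j)
        rw [h1] at this
        rw [Finset.sum_insert hj]
        convert this using 1
        ring
    refine ⟨1 + ∑ j, m j, ?_, by simpa [decomp_node] using key Finset.univ⟩
    simp only [PTree.leaves, hm, Finset.sum_add_distrib, Finset.sum_const, Finset.card_univ,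
      Fintype.card_fin, smul_eq_mul, mul_one, ← Finset.sum_mul, add_mul, one_mul]
    omega

theorem decompositions_eq (hp : 2 ≤ p) (n : ℕ) :
    decompositions d p n = {D | (∃ T : PTree d p, T.decomp = D) ∧ D.ncard = n} := by
  ext D
  constructor
  · rintro ⟨m, rfl, h⟩
    obtain ⟨T, hl, rfl⟩ := h.exists_tree hp
    exact ⟨⟨T, rfl⟩, by rw [ncard_decomp, hl]⟩
  · rintro ⟨⟨T, rfl⟩, rfl⟩
    obtain ⟨m, hl, h⟩ := exists_isDecomp hp T
    exact ⟨m, by rw [ncard_decomp, hl], h⟩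

theorem bijOn_decomp (hp : 2 ≤ p) (n : ℕ) :
    Set.BijOn PTree.decomp (maximalTrees d p n) (decompositions d p n) := by
  rw [decompositions_eq hp]
  refine ⟨?_, fun T hT T' hT' he => InterchangeMaximal.decomp_injective hp hT.2 hT'.2 he, ?_⟩
  · rintro T ⟨hn, -⟩
    exact ⟨⟨T, rfl⟩, by rw [ncard_decomp, hn]⟩
  · rintro D ⟨⟨T, rfl⟩, hn⟩
    obtain ⟨T', hT', he⟩ := exists_interchangeMaximal hp T
    exact ⟨T', ⟨by rw [← ncard_decomp, he, hn], hT'⟩, he⟩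

theorem decompSeries_eq (hp : 2 ≤ p) : decompSeries d p = rootSeries p (∅ : Finset (Fin d)) := by
  ext n
  simp [decompSeries, rootSeries, decompCount, decompositions_eq hp, withRoots]

theorem treeSeries_eq (hp : 2 ≤ p) : treeSeries d p = decompSeries d p := by
  ext n
  simp only [treeSeries, decompSeries, decompCount, PowerSeries.coeff_mk]
  rw [← (bijOn_decomp hp n).image_eq, (bijOn_decomp hp n).injOn.ncard_image]

end HypercubeTrees
end

theorem theorem24 (d p : ℕ) (hd : 1 ≤ d) (hp : 2 ≤ p) :
    (∀ n : ℕ, (HypercubeTrees.maximalTrees d p n).Finite) ∧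
    (∑ i ∈ Finset.range (d + 1),
        (-1 : PowerSeries ℤ) ^ i * (d.choose i : PowerSeries ℤ) *
          HypercubeTrees.treeSeries d p ^ p ^ i = PowerSeries.X) ∧
    (∀ n : ℕ, Set.BijOn HypercubeTrees.PTree.decomp
        (HypercubeTrees.maximalTrees d p n) (HypercubeTrees.decompositions d p n)) ∧
    (∑ i ∈ Finset.range (d + 1),
        (-1 : PowerSeries ℤ) ^ i * (d.choose i : PowerSeries ℤ) *
          HypercubeTrees.decompSeries d p ^ p ^ i = PowerSeries.X) := by
  have h := HypercubeTrees.sum_choose_mul_rootSeries_pow (d := d) hp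
  refine ⟨fun n => ?_, ?_, HypercubeTrees.bijOn_decomp hp, ?_⟩
  · exact (HypercubeTrees.finite_trees_leaves_le hp n).subset fun T hT => hT.1.le
  · rwa [HypercubeTrees.treeSeries_eq hp, HypercubeTrees.decompSeries_eq hp]
  · rwa [HypercubeTrees.decompSeries_eq hp]
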